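/- For $X=(x_1,\ldots,x_n)\in\{0,1\}^n$ let $\mathrm{Par}(X)=x_1\oplus\cdots\oplus x_n$. Let $\mathrm{R}_2(\textsc{WeakPar}_{n,\varepsilon})$ (respectively $\mathrm{Q}_2(\textsc{WeakPar}_{n,\varepsilon})$) be the minimum number of queries made by any randomized (respectively quantum) algorithm that, for at least a $1/2+\varepsilon$ fraction of the inputs $X\in\{0,1\}^n$, outputs $\mathrm{Par}(X)$ with probability at least $2/3$. Let $\mathrm{R}_0(\textsc{WeakPar}_{n,\varepsilon})$ (respectively $\mathrm{Q}_0(\textsc{WeakPar}_{n,\varepsilon})$) be the minimum number of queries made by any randomized (respectively quantum) algorithm that, for at least a $1/2+\varepsilon$ fraction of the inputs $X\in\{0,1\}^n$, outputs $\mathrm{Par}(X)$ with probability at least $2/3$ and otherwise outputs "don't know". In all cases the output on the remaining inputs may be arbitrary, and the number of queries is the worst case over all $X\in\{0,1\}^n$ (and, for randomized algorithms, over all random choices). A classical query returns $x_i$ given $i$; a quantum query maps each basis state $|i,b,z\rangle$, where $i\in\{1,\ldots,n\}$, $b\in\{0,1\}$ and $z$ is a basis state of a workspace of arbitrary finite dimension,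 to $|i,b\oplus x_i,z\rangle$; between queries a quantum algorithm applies arbitrary unitaries that do not depend on $X$, and its output is obtained by a final measurement of the workspace. Theorem. For all $n\ge 1$ and all $0<\varepsilon<\frac12$, $$\mathrm{Q}_2(\textsc{WeakPar}_{n,\varepsilon})=\Omega\left(\frac{n}{\log(1/\varepsilon)}\right),$$ and likewise $\mathrm{Q}_0(\textsc{WeakPar}_{n,\varepsilon})$, $\mathrm{R}_2(\textsc{WeakPar}_{n,\varepsilon})$ and $\mathrm{R}_0(\textsc{WeakPar}_{n,\varepsilon})$ are $\Omega\left(n/\log(1/\varepsilon)\right)$. That is, there is an absolute constant $c>0$ such that for all $n\ge1$ and all $0<\varepsilon<\frac12$ each of these four quantities is at least $c\,n/\log(1/\varepsilon)$. -/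

import Mathlib

open scoped ENNReal

namespace WeakParity

/-- Boolean inputs `X = (x_1, …, x_n) ∈ {0,1}ⁿ`. -/
abbrev Input (n : ℕ) : Type := Fin n → Bool

/-- `Par(X) = x_1 ⊕ ⋯ ⊕ x_n`. -/
def parity {n : ℕ} (X : Input n) : Bool := (List.ofFn X).foldr xor false

/-! ### Deterministic and randomized query algorithms -/

/-- Deterministic query algorithms (decision trees) on `n`-bit inputs with outputs in `O`.
`query i t₀ t₁` queries `x_i` and continues with `t₀` if `x_i = 0` and with `t₁` if `x_i = 1`. -/
inductive DecisionTree (n : ℕ) (O : Type) : Type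
  | leaf (o : O) : DecisionTree n O
  | query (i : Fin n) (t₀ t₁ : DecisionTree n O) : DecisionTree n O

namespace DecisionTree

/-- The output on input `X`. -/
def eval {n : ℕ} {O : Type} (X : Input n) : DecisionTree n O → O
  | leaf o => o
  | query i t₀ t₁ => if X i then t₁.eval X else t₀.eval X

/-- The number of queries made on input `X`. -/
def queriesOn {n : ℕ} {O : Type} (X : Input n) : DecisionTree n O → ℕ
  | leaf _ => 0
  | query i t₀ t₁ => (if X i then t₁.queriesOn X else t₀.queriesOn X) + 1

end DecisionTree

/-- A randomized query algorithm: a probability distribution on deterministic ones. -/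
abbrev RandomizedAlgorithm (n : ℕ) (O : Type) : Type := PMF (DecisionTree n O)

namespace RandomizedAlgorithm

/-- The probability that `A` outputs `o` on input `X`. -/
noncomputable def outputProb {n : ℕ} {O : Type} (A : RandomizedAlgorithm n O)
    (X : Input n) (o : O) : ℝ :=
  (PMF.map (DecisionTree.eval X) A o).toReal

/-- The number of queries, maximized over all inputs and over all random choices that occur
with nonzero probability. -/
noncomputable def numQueries {n : ℕ} {O : Type} (A : RandomizedAlgorithm n O) : ℕ∞ :=
  ⨆ t ∈ PMF.support A, ⨆ X : Input n, (t.queriesOn X : ℕ∞)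

end RandomizedAlgorithm

/-! ### Quantum query algorithms -/

/-- The labels `(i, b, z)` of the computational basis states `|i, b, z⟩`, with `i` the index
register, `b` the answer bit of a query, and `z` the workspace. -/
abbrev BasisState (n : ℕ) (W : Type) : Type := Fin n × Bool × W

/-- The query operator `|i, b, z⟩ ↦ |i, b ⊕ x_i, z⟩`, extended linearly; a vector is given by
its amplitudes. -/
def queryOp {n : ℕ} {W : Type} (X : Input n) (ψ : BasisState n W → ℂ) : BasisState n W → ℂ :=
  fun s => ψ (s.1, xor s.2.1 (X s.1), s.2.2)

/-- The action of the query operator on basis states. -/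
theorem queryOp_single {n : ℕ} {W : Type} [DecidableEq W] (X : Input n)
    (i : Fin n) (b : Bool) (z : W) :
    queryOp X (Pi.single (i, b, z) 1) = Pi.single (i, xor b (X i), z) 1 := by
  funext s
  obtain ⟨j, c, w⟩ := s
  simp only [queryOp, Pi.single_apply, Prod.mk.injEq]
  by_cases hj : j = i
  · subst hj
    cases b <;> cases c <;> cases X j <;> simp
  · simp [hj]

/-- A quantum query algorithm on `n`-bit inputs with outputs in `O`. It starts in a basis state,
applies a unitary `U₀`, and then, for each unitary `U` in the list `steps`, makes one query and
applies `U`. None of these data depends on the input. Finally the workspace is measured, and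
`output` reads the answer off the result. -/
structure QuantumAlgorithm (n : ℕ) (O : Type) : Type 1 where
  W : Type
  [fintypeW : Fintype W]
  [decEqW : DecidableEq W]
  init : BasisState n W
  U₀ : Matrix.unitaryGroup (BasisState n W) ℂ
  steps : List (Matrix.unitaryGroup (BasisState n W) ℂ)
  output : W → O

namespace QuantumAlgorithm

attribute [instance] fintypeW decEqW

/-- The number of queries; it is the same on every input. -/
def numQueries {n : ℕ} {O : Type} (A : QuantumAlgorithm n O) : ℕ := A.steps.length

/-- The state before the final measurement, on input `X`. -/
noncomputable def finalState {n : ℕ} {O : Type} (A : QuantumAlgorithm n O) (X : Input n) :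
    BasisState n A.W → ℂ :=
  A.steps.foldl (fun ψ U => Matrix.mulVec U.1 (queryOp X ψ))
    (Matrix.mulVec A.U₀.1 (Pi.single A.init 1))

/-- The probability that `A` outputs `o` on input `X`. -/
noncomputable def outputProb {n : ℕ} {O : Type} [DecidableEq O] (A : QuantumAlgorithm n O)
    (X : Input n) (o : O) : ℝ :=
  ∑ s : BasisState n A.W, if A.output s.2.2 = o then ‖A.finalState X s‖ ^ 2 else 0

end QuantumAlgorithm

/-! ### Weak Parity

Below, `prob X o` is the probability that an algorithm outputs `o` on input `X`. -/

/-- Bounded-error success: on at least a `1/2 + ε` fraction of the inputs `X ∈ {0,1}ⁿ`,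
the output is `Par(X)` with probability at least `2/3`. -/
def SolvesBoundedError {n : ℕ} (ε : ℝ) (prob : Input n → Bool → ℝ) : Prop :=
  (1 / 2 + ε) * 2 ^ n ≤ (Set.ncard {X : Input n | 2 / 3 ≤ prob X (parity X)} : ℝ)

/-- Zero-error success: on at least a `1/2 + ε` fraction of the inputs `X ∈ {0,1}ⁿ`, the output
is `Par(X)` with probability at least `2/3`, and is "don't know" (`none`) otherwise, so that the
wrong bit is output with probability zero. -/
def SolvesZeroError {n : ℕ} (ε : ℝ) (prob : Input n → Option Bool → ℝ) : Prop :=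
  (1 / 2 + ε) * 2 ^ n ≤
    (Set.ncard {X : Input n | 2 / 3 ≤ prob X (some (parity X)) ∧
      prob X (some (!parity X)) = 0} : ℝ)

/-- `Q₂(WeakPar_{n,ε})`, the bounded-error quantum query complexity. -/
noncomputable def Q2 (n : ℕ) (ε : ℝ) : ℕ∞ :=
  ⨅ (A : QuantumAlgorithm n Bool) (_ : SolvesBoundedError ε A.outputProb), (A.numQueries : ℕ∞)

/-- `Q₀(WeakPar_{n,ε})`, the zero-error quantum query complexity. -/
noncomputable def Q0 (n : ℕ) (ε : ℝ) : ℕ∞ :=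
  ⨅ (A : QuantumAlgorithm n (Option Bool)) (_ : SolvesZeroError ε A.outputProb),
    (A.numQueries : ℕ∞)

/-- `R₂(WeakPar_{n,ε})`, the bounded-error randomized query complexity. -/
noncomputable def R2 (n : ℕ) (ε : ℝ) : ℕ∞ :=
  ⨅ (A : RandomizedAlgorithm n Bool)
    (_ : SolvesBoundedError ε (RandomizedAlgorithm.outputProb A)),
    RandomizedAlgorithm.numQueries A

/-- `R₀(WeakPar_{n,ε})`, the zero-error randomized query complexity. -/
noncomputable def R0 (n : ℕ) (ε : ℝ) : ℕ∞ :=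
  ⨅ (A : RandomizedAlgorithm n (Option Bool))
    (_ : SolvesZeroError ε (RandomizedAlgorithm.outputProb A)),
    RandomizedAlgorithm.numQueries A

end WeakParity

/-! The proof is by the polynomial method. The acceptance probability of a `T`-query quantum
algorithm is a function on the cube of degree at most `2T`, and of a randomized one at most `T`. A
function of degree below `n` is orthogonal to the sign of parity (`sum_mul_signPar_eq_zero`). This
alone gives no contradiction: success probability 2/3 yields only correlation 1/3 on a good input,
while a bad input may cost 1. So the probability is first amplified by substituting it into the
majority polynomial of `2m+1` coins, which multiplies the degree by `2m+1` and leaves error `δ =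
(8/9)^m/3` on good inputs. Once `δ < ε` the correlation is positive, forcing `n ≤ (2m+1)d`
(`le_mul_degree`), and `m` of order `log(1/ε)` suffices. Zero-error algorithms reduce to
bounded-error ones by replacing "don't know" with a bit. -/

namespace WeakParity

open Finset

/-! ### Functions of bounded degree on the cube -/

/-- `f` depends only on the coordinates in `S`. -/
def IsJunta {n : ℕ} (S : Finset (Fin n)) (f : Input n → ℂ) : Prop :=
  ∀ X Y : Input n, (∀ i ∈ S, X i = Y i) → f X = f Y

/-- The functions on the cube of degree at most `d`: the span of the `d`-juntas. -/
noncomputable def degreeLE (n d : ℕ) : Submodule ℂ (Input n → ℂ) :=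
  Submodule.span ℂ {f | ∃ S : Finset (Fin n), #S ≤ d ∧ IsJunta S f}

theorem IsJunta.mem_degreeLE {n d : ℕ} {S : Finset (Fin n)} {f : Input n → ℂ}
    (hf : IsJunta S f) (hS : #S ≤ d) : f ∈ degreeLE n d :=
  Submodule.subset_span ⟨S, hS, hf⟩

theorem degreeLE_mono {n : ℕ} {a b : ℕ} (h : a ≤ b) : degreeLE n a ≤ degreeLE n b :=
  Submodule.span_mono fun _ ⟨S, hS, hf⟩ => ⟨S, hS.trans h, hf⟩

theorem const_mem_degreeLE {n d : ℕ} (c : ℂ) : (fun _ => c) ∈ degreeLE n d :=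
  IsJunta.mem_degreeLE (S := ∅) (fun _ _ _ => rfl) (by simp)

theorem mul_mem_degreeLE {n a b : ℕ} {f g : Input n → ℂ} (hf : f ∈ degreeLE n a)
    (hg : g ∈ degreeLE n b) : f * g ∈ degreeLE n (a + b) := by
  classical
  have h := Submodule.mul_mem_mul hf hg
  rw [degreeLE, degreeLE, Submodule.span_mul_span] at h
  refine Submodule.span_mono ?_ h
  rintro _ ⟨f, ⟨S, hS, hf⟩, g, ⟨T, hT, hg⟩, rfl⟩
  refine ⟨S ∪ T, (card_union_le S T).trans (add_le_add hS hT), fun X Y h => ?_⟩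
  change f X * g X = f Y * g Y
  rw [hf X Y fun i hi => h i (mem_union_left _ hi), hg X Y fun i hi => h i (mem_union_right _ hi)]

theorem pow_mem_degreeLE {n d : ℕ} {f : Input n → ℂ} (hf : f ∈ degreeLE n d) (k : ℕ) :
    f ^ k ∈ degreeLE n (k * d) := by
  induction k with
  | zero => rw [pow_zero]; exact const_mem_degreeLE 1
  | succ k ih => rw [pow_succ, Nat.succ_mul]; exact mul_mem_degreeLE ih hf

theorem star_mem_degreeLE {n d : ℕ} {f : Input n → ℂ} (hf : f ∈ degreeLE n d) :
    star f ∈ degreeLE n d := by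
  induction hf using Submodule.span_induction with
  | mem f hf =>
    obtain ⟨S, hS, hf⟩ := hf
    exact IsJunta.mem_degreeLE (S := S) (fun X Y h => congrArg star (hf X Y h)) hS
  | zero => simp
  | add f g _ _ hf hg => rw [star_add]; exact add_mem hf hg
  | smul c f _ hf => rw [star_smul]; exact Submodule.smul_mem _ _ hf

/-- The degree cost of one query, shared by quantum query operators and decision-tree branchings. -/
theorem ite_mem_degreeLE {n d : ℕ} (i : Fin n) {f g : Input n → ℂ} (hf : f ∈ degreeLE n d)
    (hg : g ∈ degreeLE n d) : (fun X => if X i then f X else g X) ∈ degreeLE n (d + 1) := by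
  have key (u v : ℂ) : (fun X : Input n => if X i then u else v) ∈ degreeLE n 1 :=
    IsJunta.mem_degreeLE (S := {i}) (fun X Y h => by simp [h i (by simp)]) (by simp)
  convert add_mem (mul_mem_degreeLE hf (key 1 0)) (mul_mem_degreeLE hg (key 0 1)) using 1
  funext X
  by_cases h : X i <;> simp [h]

/-! ### Correlation with parity -/

/-- Parity with values in `{1, -1}`; it is `1` when the parity bit is `1`. -/
def signPar {n : ℕ} (X : Input n) : ℝ := if parity X then 1 else -1

theorem signPar_eq_prod {n : ℕ} (X : Input n) : signPar X = -∏ i, if X i then -1 else 1 := by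
  induction n with
  | zero => simp [signPar, parity]
  | succ n ih =>
    have h := ih fun i => X i.succ
    rw [Fin.prod_univ_succ, mul_comm, ← neg_mul, ← h]
    have hpar : parity X = xor (X 0) (parity fun i => X i.succ) := by
      simp [parity, List.ofFn_succ]
    rw [signPar, signPar, hpar]
    cases X 0 <;> cases parity fun i => X i.succ <;> simp

theorem signPar_update {n : ℕ} (X : Input n) (i : Fin n) :
    signPar (Function.update X i (!X i)) = -signPar X := by
  rw [signPar_eq_prod, signPar_eq_prod, ← mul_prod_erase _ _ (mem_univ i),
    ← mul_prod_erase univ (fun j => if X j then (-1 : ℝ) else 1) (mem_univ i)]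
  have h : ∏ x ∈ univ.erase i, (if Function.update X i (!X i) x then (-1 : ℝ) else 1) =
      ∏ x ∈ univ.erase i, if X x then (-1 : ℝ) else 1 :=
    prod_congr rfl fun j hj => by rw [Function.update_of_ne (ne_of_mem_erase hj)]
  rw [h]
  cases hX : X i <;> simp

/-- A junta on fewer than `n` coordinates ignores some coordinate; flipping it pairs the inputs into
cancelling pairs. Linearity does the rest. -/
theorem sum_mul_signPar_eq_zero {n d : ℕ} (hd : d < n) {f : Input n → ℂ}
    (hf : f ∈ degreeLE n d) : ∑ X, f X * (signPar X : ℂ) = 0 := by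
  classical
  induction hf using Submodule.span_induction with
  | mem f hf =>
    obtain ⟨S, hS, hf⟩ := hf
    obtain ⟨i, hi⟩ : ∃ i, i ∉ S := by
      by_contra! h
      have := card_le_card (fun i _ => h i : (univ : Finset (Fin n)) ⊆ S)
      simp at this
      omega
    refine sum_involution (fun X _ => Function.update X i (!X i)) (fun X _ => ?_)
      (fun X _ _ h => ?_) (fun _ _ => mem_univ _) (fun X _ => by simp)
    · rw [signPar_update, ← hf X (Function.update X i (!X i)) fun j hj => ?_]
      · push_cast; ring
      · rw [Function.update_of_ne (by rintro rfl; exact hi hj)]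
    · simpa using congrFun h i
  | zero => simp
  | add f g _ _ hf hg => simp [add_mul, sum_add_distrib, hf, hg]
  | smul c f _ hf => simp [mul_assoc, ← mul_sum, hf]

/-! ### The majority polynomial -/

/-- The probability that more than half of `2 * m + 1` independent coins of bias `p` show `1`. -/
def majority (m : ℕ) (p : ℝ) : ℝ :=
  ∑ i ∈ range (m + 1), ((2 * m + 1).choose i : ℝ) * ((1 - p) ^ i * p ^ (2 * m + 1 - i))

theorem majority_nonneg (m : ℕ) {p : ℝ} (h0 : 0 ≤ p) (h1 : p ≤ 1) : 0 ≤ majority m p := by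
  have : 0 ≤ 1 - p := by linarith
  exact sum_nonneg fun i _ => by positivity

/-- An odd number of coins has no ties. The two halves of the binomial expansion of `((1 - p) +
p)^(2m+1)` are the two majorities; reflecting the index exchanges zeros and ones. -/
theorem majority_one_sub (m : ℕ) (p : ℝ) : majority m p + majority m (1 - p) = 1 := by
  have h := add_pow (1 - p) p (2 * m + 1)
  rw [sub_add_cancel, one_pow, show 2 * m + 1 + 1 = (m + 1) + (m + 1) by ring,
    sum_range_add] at h
  refine Eq.trans ?_ h.symm
  rw [majority, majority]
  congr 1
  · exact sum_congr rfl fun i _ => by ring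
  · rw [← sum_range_reflect]
    refine sum_congr rfl fun i hi => ?_
    have hi : i ≤ m := by simpa [Nat.lt_succ_iff] using hi
    have e2 : m + 1 + i = 2 * m + 1 - (m - i) := by omega
    have e3 : m + 1 - 1 - i = m - i := by omega
    rw [e3, e2, ← Nat.choose_symm (show m - i ≤ 2 * m + 1 by omega)]
    rw [sub_sub_cancel, show 2 * m + 1 - (2 * m + 1 - (m - i)) = m - i by omega]
    ring

/-- As `p ≤ 1 - p`, trading surplus factors `p` for `1 - p` bounds each term by its binomial
coefficient times `((1 - p)p)^m * p`, at most `(2/9)^m / 3`. The coefficients, half a row of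
Pascal's triangle, sum to `4^m`. -/
theorem majority_le (m : ℕ) {p : ℝ} (h0 : 0 ≤ p) (h1 : p ≤ 1 / 3) :
    majority m p ≤ (8 / 9) ^ m / 3 := by
  have hq : 0 ≤ 1 - p := by linarith
  have hterm (i : ℕ) (hi : i ∈ range (m + 1)) :
      ((2 * m + 1).choose i : ℝ) * ((1 - p) ^ i * p ^ (2 * m + 1 - i)) ≤
        ((2 * m + 1).choose i : ℝ) * ((2 / 9) ^ m * (1 / 3)) := by
    have hi : i ≤ m := by simpa [Nat.lt_succ_iff] using hi
    obtain ⟨j, rfl⟩ := Nat.exists_eq_add_of_le hi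
    refine mul_le_mul_of_nonneg_left ?_ (by positivity)
    calc (1 - p) ^ i * p ^ (2 * (i + j) + 1 - i)
        = (1 - p) ^ i * p ^ j * p ^ (i + j) * p := by
          rw [show 2 * (i + j) + 1 - i = j + (i + j) + 1 by omega]; ring
      _ ≤ (1 - p) ^ i * (1 - p) ^ j * p ^ (i + j) * p := by
          gcongr; linarith
      _ = ((1 - p) * p) ^ (i + j) * p := by rw [mul_pow]; ring
      _ ≤ (2 / 9) ^ (i + j) * (1 / 3) := by
          gcongr; nlinarith
  calc majority m p ≤ _ := sum_le_sum hterm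
    _ = (8 / 9) ^ m / 3 := by
      rw [← sum_mul, ← Nat.cast_sum, Nat.sum_range_choose_halfway]
      push_cast
      rw [← mul_assoc, ← mul_pow]
      norm_num [div_eq_mul_inv]

theorem majority_mem_degreeLE {n d : ℕ} (m : ℕ) {p : Input n → ℝ}
    (hp : (fun X => (p X : ℂ)) ∈ degreeLE n d) :
    (fun X => (majority m (p X) : ℂ)) ∈ degreeLE n ((2 * m + 1) * d) := by
  have h : (fun X => (majority m (p X) : ℂ)) = ∑ i ∈ range (m + 1),
      ((2 * m + 1).choose i : ℂ) • (((fun _ => 1) - fun X => (p X : ℂ)) ^ i *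
        (fun X => (p X : ℂ)) ^ (2 * m + 1 - i)) := by
    funext X
    simp [majority]
  rw [h]
  refine sum_mem fun i hi => Submodule.smul_mem _ _ ?_
  have hi : i ≤ m := by simpa [Nat.lt_succ_iff] using hi
  convert mul_mem_degreeLE (pow_mem_degreeLE (sub_mem (const_mem_degreeLE 1) hp) i)
    (pow_mem_degreeLE hp (2 * m + 1 - i)) using 2
  rw [← add_mul]
  congr 1
  omega

/-! ### The degree bound for Weak Parity -/

theorem le_mul_degree {n d : ℕ} {ε : ℝ} {prob : Input n → Bool → ℝ}
    (h0 : ∀ X o, 0 ≤ prob X o) (h1 : ∀ X, prob X true + prob X false = 1)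
    (hd : (fun X => (prob X true : ℂ)) ∈ degreeLE n d) (hs : SolvesBoundedError ε prob)
    (m : ℕ) (hm : (8 / 9 : ℝ) ^ m / 3 < ε) : n ≤ (2 * m + 1) * d := by
  classical
  by_contra! hn
  set q : Input n → ℝ := fun X => majority m (prob X true) with hq
  set δ : ℝ := (8 / 9 : ℝ) ^ m / 3 with hδ
  have hδ0 : 0 ≤ δ := by positivity
  have hqs (X : Input n) : q X + majority m (prob X false) = 1 := by
    rw [← majority_one_sub m (prob X true), hq, ← h1 X, add_sub_cancel_left]
  have hq0 (X : Input n) : 0 ≤ q X :=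
    majority_nonneg m (h0 X true) (by linarith [h0 X false, h1 X])
  have hq1 (X : Input n) : q X ≤ 1 := by
    linarith [hqs X, majority_nonneg m (h0 X false) (by linarith [h0 X true, h1 X])]
  have hzero : ∑ X, (2 * q X - 1) * signPar X = 0 := by
    have h := sum_mul_signPar_eq_zero hn (sub_mem
      (Submodule.smul_mem _ (2 : ℂ) (majority_mem_degreeLE m hd)) (const_mem_degreeLE 1))
    simp only [Pi.sub_apply, Pi.smul_apply, smul_eq_mul] at h
    exact_mod_cast h
  set G : Finset (Input n) := univ.filter fun X => 2 / 3 ≤ prob X (parity X) with hG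
  -- A good input contributes at least `1 - 2δ`, any other at least `-1`; splitting off the `-1`
  -- makes the sum `(2 - 2δ) * #G - 2^n`.
  have hlow (X : Input n) :
      (if X ∈ G then 2 - 2 * δ else 0) - 1 ≤ (2 * q X - 1) * signPar X := by
    by_cases hX : X ∈ G
    · have hX' : 2 / 3 ≤ prob X (parity X) := by simpa [hG] using hX
      rw [if_pos hX, signPar]
      cases hp : parity X
      · rw [hp] at hX'
        have := majority_le m (h0 X true) (by linarith [h1 X])
        simp only [Bool.false_eq_true, if_false]
        change q X ≤ δ at this
        linarith
      · rw [hp] at hX'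
        have := majority_le m (h0 X false) (by linarith [h1 X])
        rw [if_pos rfl]
        linarith [hqs X]
    · rw [if_neg hX, signPar]
      split_ifs <;> linarith [hq0 X, hq1 X]
  have hsum := sum_le_sum fun X (_ : X ∈ univ) => hlow X
  rw [hzero, sum_sub_distrib, ← sum_filter, filter_mem_eq_inter, univ_inter, sum_const,
    sum_const, card_univ, nsmul_eq_mul, nsmul_eq_mul] at hsum
  have hcard : (Fintype.card (Input n) : ℝ) = 2 ^ n := by simp [Input]
  have hGcard : (1 / 2 + ε) * 2 ^ n ≤ (#G : ℝ) := by
    have hset : {X : Input n | 2 / 3 ≤ prob X (parity X)} = (G : Set (Input n)) := by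
      ext X; simp [hG]
    rwa [SolvesBoundedError, hset, Set.ncard_coe_finset] at hs
  have hGle : (#G : ℝ) ≤ 2 ^ n := by rw [← hcard]; exact_mod_cast card_le_univ G
  have hpos : (0 : ℝ) < 2 ^ n := by positivity
  rw [hcard] at hsum
  -- The correlation is at least `2ε * 2^n - 2δ * #G ≥ 2(ε - δ) * 2^n > 0`.
  nlinarith [mul_le_mul_of_nonneg_right hGle hδ0, mul_lt_mul_of_pos_right hm hpos]

theorem div_log_le_of_solves {n T : ℕ} {ε : ℝ} (hε : 0 < ε) (hε' : ε < 1 / 2)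
    {prob : Input n → Bool → ℝ}
    (h0 : ∀ X o, 0 ≤ prob X o) (h1 : ∀ X, prob X true + prob X false = 1)
    (hd : (fun X => (prob X true : ℂ)) ∈ degreeLE n (2 * T)) (hs : SolvesBoundedError ε prob) :
    1 / 48 * n / Real.log (1 / ε) ≤ T := by
  set L := Real.log (1 / ε) with hL
  have hL2 : Real.log 2 ≤ L :=
    Real.log_le_log two_pos (by rw [le_div_iff₀ hε]; linarith)
  have hL0 : 0.6 < L := by linarith [Real.log_two_gt_d9]
  -- Since `8/9 ≤ exp(-1/9)`, this gives `(8/9)^m ≤ ε`; the factor 1/3 in the error makes the bound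
  -- strict. As `L > 0.6`, `2m + 1 ≤ 18L + 3 ≤ 24L`, and degree `2T` turns 24 into 48.
  set m := ⌈9 * L⌉₊ with hm
  have hm1 : 9 * L ≤ m := Nat.le_ceil _
  have hm2 : (m : ℝ) < 9 * L + 1 := Nat.ceil_lt_add_one (by linarith)
  have hpow : (8 / 9 : ℝ) ^ m ≤ ε := by
    calc (8 / 9 : ℝ) ^ m ≤ Real.exp (-(1 / 9)) ^ m := by
          gcongr
          linarith [Real.add_one_le_exp (-(1 / 9 : ℝ))]
      _ = Real.exp (m * -(1 / 9)) := (Real.exp_nat_mul _ _).symm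
      _ ≤ Real.exp (-L) := Real.exp_le_exp.2 (by linarith)
      _ = ε := by rw [hL, one_div, Real.log_inv, neg_neg, Real.exp_log hε]
  have h := le_mul_degree h0 h1 hd hs m (by linarith)
  have h' : (n : ℝ) ≤ (2 * m + 1) * (2 * T) := by exact_mod_cast h
  rw [div_le_iff₀ (by linarith)]
  have hT : (0 : ℝ) ≤ T := T.cast_nonneg
  nlinarith [mul_le_mul_of_nonneg_right (show (2 * m + 1 : ℝ) ≤ 24 * L by linarith) hT]

/-! ### Quantum algorithms -/

namespace QuantumAlgorithm

theorem mulVec_mem_degreeLE {n d : ℕ} {ι : Type*} [Fintype ι] (U : Matrix ι ι ℂ)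
    {ψ : Input n → ι → ℂ} (hψ : ∀ s, (fun X => ψ X s) ∈ degreeLE n d) (s : ι) :
    (fun X => U.mulVec (ψ X) s) ∈ degreeLE n d := by
  have h : (fun X => U.mulVec (ψ X) s) = ∑ t, U s t • fun X => ψ X t := by
    funext X; simp [Matrix.mulVec, dotProduct]
  rw [h]
  exact sum_mem fun t _ => Submodule.smul_mem _ _ (hψ t)

theorem queryOp_mem_degreeLE {n d : ℕ} {W : Type} {ψ : Input n → BasisState n W → ℂ}
    (hψ : ∀ s, (fun X => ψ X s) ∈ degreeLE n d) (s : BasisState n W) :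
    (fun X => queryOp X (ψ X) s) ∈ degreeLE n (d + 1) := by
  convert ite_mem_degreeLE s.1 (hψ (s.1, !s.2.1, s.2.2)) (hψ (s.1, s.2.1, s.2.2)) using 1
  funext X
  cases h : X s.1 <;> simp [queryOp, h]

theorem foldl_mem_degreeLE {n : ℕ} {W : Type} [Fintype W] [DecidableEq W]
    (l : List (Matrix.unitaryGroup (BasisState n W) ℂ)) {d : ℕ}
    {ψ : Input n → BasisState n W → ℂ}
    (hψ : ∀ s, (fun X => ψ X s) ∈ degreeLE n d) (s : BasisState n W) :
    (fun X => l.foldl (fun ψ U => Matrix.mulVec U.1 (queryOp X ψ)) (ψ X) s) ∈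
      degreeLE n (d + l.length) := by
  induction l generalizing d ψ with
  | nil => exact hψ s
  | cons U l ih =>
    rw [List.length_cons, ← Nat.add_assoc, Nat.add_right_comm]
    exact ih fun t => mulVec_mem_degreeLE U.1 (queryOp_mem_degreeLE hψ) t

variable {n : ℕ} {O : Type}

theorem finalState_mem_degreeLE (A : QuantumAlgorithm n O) (s : BasisState n A.W) :
    (fun X => A.finalState X s) ∈ degreeLE n A.numQueries := by
  rw [← Nat.zero_add A.numQueries]
  exact foldl_mem_degreeLE A.steps
    (ψ := fun _ => Matrix.mulVec A.U₀.1 (Pi.single A.init 1)) (fun t => const_mem_degreeLE _) s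

/-- Each amplitude has degree at most the number of queries; multiplying by its conjugate doubles
this. -/
theorem outputProb_mem_degreeLE [DecidableEq O] (A : QuantumAlgorithm n O) (o : O) :
    (fun X => (A.outputProb X o : ℂ)) ∈ degreeLE n (2 * A.numQueries) := by
  have h : (fun X => (A.outputProb X o : ℂ)) = ∑ s : BasisState n A.W,
      (if A.output s.2.2 = o then (1 : ℂ) else 0) •
        (star (fun X => A.finalState X s) * fun X => A.finalState X s) := by
    funext X
    simp only [outputProb, Complex.ofReal_sum, Finset.sum_apply, Pi.smul_apply, Pi.mul_apply,
      Pi.star_apply, smul_eq_mul]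
    refine sum_congr rfl fun s _ => ?_
    split_ifs
    · rw [one_mul, Complex.star_def, Complex.conj_mul']
      push_cast; rfl
    · simp
  rw [h, two_mul]
  exact sum_mem fun s _ => Submodule.smul_mem _ _ (mul_mem_degreeLE
    (star_mem_degreeLE (A.finalState_mem_degreeLE s)) (A.finalState_mem_degreeLE s))

theorem sum_norm_sq_mulVec {ι : Type*} [Fintype ι] [DecidableEq ι]
    (U : Matrix.unitaryGroup ι ℂ) (v : ι → ℂ) :
    ∑ s, ‖U.1.mulVec v s‖ ^ 2 = ∑ s, ‖v s‖ ^ 2 := by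
  have key (w : ι → ℂ) : ((∑ s, ‖w s‖ ^ 2 : ℝ) : ℂ) = star w ⬝ᵥ w := by
    simp [dotProduct, Complex.conj_mul']
  have hU : U.1.conjTranspose * U.1 = 1 := Matrix.UnitaryGroup.star_mul_self U
  apply Complex.ofReal_injective
  rw [key, key, Matrix.star_mulVec, Matrix.dotProduct_mulVec, Matrix.vecMul_vecMul, hU,
    Matrix.vecMul_one]

theorem sum_norm_sq_queryOp {W : Type} [Fintype W] (X : Input n) (ψ : BasisState n W → ℂ) :
    ∑ s, ‖queryOp X ψ s‖ ^ 2 = ∑ s, ‖ψ s‖ ^ 2 := by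
  have hinv : Function.Involutive
      fun s : BasisState n W => ((s.1, xor s.2.1 (X s.1), s.2.2) : BasisState n W) := fun s => by
    simp
  exact Equiv.sum_comp hinv.toPerm fun s => ‖ψ s‖ ^ 2

theorem sum_norm_sq_finalState (A : QuantumAlgorithm n O) (X : Input n) :
    ∑ s, ‖A.finalState X s‖ ^ 2 = 1 := by
  have key (l : List (Matrix.unitaryGroup (BasisState n A.W) ℂ)) (ψ : BasisState n A.W → ℂ) :
      ∑ s, ‖l.foldl (fun ψ U => Matrix.mulVec U.1 (queryOp X ψ)) ψ s‖ ^ 2 = ∑ s, ‖ψ s‖ ^ 2 := by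
    induction l generalizing ψ with
    | nil => rfl
    | cons U l ih => rw [List.foldl_cons, ih, sum_norm_sq_mulVec, sum_norm_sq_queryOp]
  rw [finalState, key, sum_norm_sq_mulVec, sum_eq_single A.init] <;> simp +contextual

theorem outputProb_nonneg [DecidableEq O] (A : QuantumAlgorithm n O) (X : Input n) (o : O) :
    0 ≤ A.outputProb X o :=
  sum_nonneg fun s _ => by split_ifs <;> positivity

theorem outputProb_true_add_false (A : QuantumAlgorithm n Bool) (X : Input n) :
    A.outputProb X true + A.outputProb X false = 1 := by
  rw [outputProb, outputProb, ← sum_add_distrib, ← A.sum_norm_sq_finalState X]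
  refine sum_congr rfl fun s _ => ?_
  cases A.output s.2.2 <;> simp

/-- Postprocessing of the output. -/
def mapOutput {P : Type} (g : O → P) (A : QuantumAlgorithm n O) : QuantumAlgorithm n P where
  W := A.W
  init := A.init
  U₀ := A.U₀
  steps := A.steps
  output := g ∘ A.output

theorem outputProb_mapOutput_ge [DecidableEq O] {P : Type} [DecidableEq P] (g : O → P)
    (A : QuantumAlgorithm n O) (X : Input n) (o : O) :
    A.outputProb X o ≤ (A.mapOutput g).outputProb X (g o) := by
  refine sum_le_sum fun s _ => ?_
  change (if A.output s.2.2 = o then ‖A.finalState X s‖ ^ 2 else 0) ≤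
    if g (A.output s.2.2) = g o then ‖A.finalState X s‖ ^ 2 else 0
  by_cases h : A.output s.2.2 = o
  · simp [h]
  · rw [if_neg h]
    split_ifs <;> positivity

end QuantumAlgorithm

/-! ### Randomized algorithms -/

/-- A tree may be deep along branches that no input reaches, so its depth is not bounded by its
query count. The function `F` comes from cutting the tree off at depth `d`, which is harmless on
inputs making at most `d` queries. -/
theorem DecisionTree.exists_mem_degreeLE {n : ℕ} {O : Type} [DecidableEq O] (o : O)
    (t : DecisionTree n O) (d : ℕ) : ∃ F ∈ degreeLE n d, ∀ X : Input n,
      t.queriesOn X ≤ d → F X = if t.eval X = o then 1 else 0 := by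
  induction t generalizing d with
  | leaf a => exact ⟨_, const_mem_degreeLE (if a = o then 1 else 0), fun X _ => rfl⟩
  | query i t₀ t₁ ih₀ ih₁ =>
    cases d with
    | zero => exact ⟨0, zero_mem _, fun X h => by simp [queriesOn] at h⟩
    | succ d =>
      obtain ⟨F₀, hF₀, h₀⟩ := ih₀ d
      obtain ⟨F₁, hF₁, h₁⟩ := ih₁ d
      refine ⟨_, ite_mem_degreeLE i hF₁ hF₀, fun X h => ?_⟩
      cases hX : X i
      · simp only [queriesOn, hX, eval] at h ⊢
        simpa using h₀ X (by simpa using h)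
      · simp only [queriesOn, hX, eval] at h ⊢
        simpa using h₁ X (by simpa using h)

namespace RandomizedAlgorithm

variable {n : ℕ} {O : Type}

theorem hasSum_outputProb [DecidableEq O] (A : RandomizedAlgorithm n O) (X : Input n) (o : O) :
    HasSum (fun t => (A t).toReal * if t.eval X = o then 1 else 0) (outputProb A X o) := by
  have hmap : PMF.map (DecisionTree.eval X) A o = ∑' t, if t.eval X = o then A t else 0 := by
    rw [PMF.map_apply]
    refine tsum_congr fun t => ?_
    by_cases ht : t.eval X = o
    · simp [ht]
    · simp [ht, Ne.symm ht]
  have hne (t : DecisionTree n O) : (if t.eval X = o then A t else 0) ≠ ∞ := by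
    split_ifs
    · exact A.apply_ne_top t
    · simp
  have hsum : ∑' t, (if t.eval X = o then A t else 0) ≠ ∞ := by
    rw [← hmap]
    exact PMF.apply_ne_top _ _
  have h := ENNReal.hasSum_toReal hsum
  rw [← ENNReal.tsum_toReal_eq hne, ← hmap] at h
  rw [outputProb]
  convert h using 2 with t
  split_ifs <;> simp

theorem outputProb_mem_degreeLE [DecidableEq O] (A : RandomizedAlgorithm n O) (o : O) {T : ℕ}
    (hT : numQueries A ≤ T) : (fun X => (outputProb A X o : ℂ)) ∈ degreeLE n T := by
  have hsum : HasSum (fun t X => (((A t).toReal * if t.eval X = o then 1 else 0 : ℝ) : ℂ))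
      (fun X => (outputProb A X o : ℂ)) :=
    Pi.hasSum.2 fun X => Complex.hasSum_ofReal.2 (hasSum_outputProb A X o)
  -- The distribution may have infinite support, so the probability is a limit of finite
  -- combinations; a finite-dimensional subspace is closed.
  refine (Submodule.closed_of_finiteDimensional (degreeLE n T)).mem_of_tendsto hsum
    (Filter.Eventually.of_forall fun s => sum_mem fun t _ => ?_)
  by_cases ht : t ∈ A.support
  · obtain ⟨F, hF, h⟩ := t.exists_mem_degreeLE o T
    convert Submodule.smul_mem _ ((A t).toReal : ℂ) hF using 1
    funext X
    have hX : t.queriesOn X ≤ T := by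
      have := (le_iSup₂_of_le t ht (le_iSup (fun X => (t.queriesOn X : ℕ∞)) X)).trans hT
      exact_mod_cast this
    rw [Pi.smul_apply, h X hX]
    split_ifs <;> simp
  · rw [PMF.mem_support_iff, not_not] at ht
    convert zero_mem (degreeLE n T)
    simp [ht]

theorem outputProb_true_add_false (A : RandomizedAlgorithm n Bool) (X : Input n) :
    outputProb A X true + outputProb A X false = 1 := by
  have h := (PMF.map (DecisionTree.eval X) A).tsum_coe
  rw [tsum_bool] at h
  rw [outputProb, outputProb, ← ENNReal.toReal_add (PMF.apply_ne_top _ _) (PMF.apply_ne_top _ _),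
    add_comm, h, ENNReal.toReal_one]

end RandomizedAlgorithm

/-- Postprocessing of the output of a decision tree. -/
def DecisionTree.mapOutput {n : ℕ} {O P : Type} (g : O → P) : DecisionTree n O → DecisionTree n P
  | leaf o => leaf (g o)
  | query i t₀ t₁ => query i (t₀.mapOutput g) (t₁.mapOutput g)

theorem DecisionTree.eval_mapOutput {n : ℕ} {O P : Type} (g : O → P) (t : DecisionTree n O)
    (X : Input n) : (t.mapOutput g).eval X = g (t.eval X) := by
  induction t with
  | leaf o => rfl
  | query i t₀ t₁ h₀ h₁ => simp only [mapOutput, eval, h₀, h₁]; split_ifs <;> rfl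

theorem DecisionTree.queriesOn_mapOutput {n : ℕ} {O P : Type} (g : O → P) (t : DecisionTree n O)
    (X : Input n) : (t.mapOutput g).queriesOn X = t.queriesOn X := by
  induction t with
  | leaf o => rfl
  | query i t₀ t₁ h₀ h₁ => simp only [mapOutput, queriesOn, h₀, h₁]

namespace RandomizedAlgorithm

variable {n : ℕ} {O P : Type}

/-- Postprocessing of the output of a randomized algorithm. -/
noncomputable def mapOutput (g : O → P) (A : RandomizedAlgorithm n O) : RandomizedAlgorithm n P :=
  PMF.map (DecisionTree.mapOutput g) A

theorem outputProb_mapOutput_ge (g : O → P) (A : RandomizedAlgorithm n O) (X : Input n) (o : O) :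
    outputProb A X o ≤ outputProb (A.mapOutput g) X (g o) := by
  classical
  have h : PMF.map (DecisionTree.eval X) (A.mapOutput g) =
      PMF.map g (PMF.map (DecisionTree.eval X) A) := by
    rw [mapOutput, PMF.map_comp, PMF.map_comp]
    congr 1
    funext t
    exact t.eval_mapOutput g X
  rw [outputProb, outputProb, h]
  refine ENNReal.toReal_mono (PMF.apply_ne_top _ _) ?_
  rw [PMF.map_apply]
  exact le_trans (by simp) (ENNReal.le_tsum o)

theorem numQueries_mapOutput_le (g : O → P) (A : RandomizedAlgorithm n O) :
    numQueries (A.mapOutput g) ≤ numQueries A := by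
  refine iSup₂_le fun t ht => ?_
  obtain ⟨u, hu, rfl⟩ := (PMF.mem_support_map_iff _ _ _).1 ht
  simp only [DecisionTree.queriesOn_mapOutput]
  exact le_iSup₂_of_le u hu le_rfl

end RandomizedAlgorithm

/-! ### Lower bounds -/

theorem SolvesZeroError.solvesBoundedError {n : ℕ} {ε : ℝ} {prob : Input n → Option Bool → ℝ}
    {prob' : Input n → Bool → ℝ} (h : ∀ X b, prob X (some b) ≤ prob' X b)
    (hs : SolvesZeroError ε prob) : SolvesBoundedError ε prob' := by
  refine le_trans hs ?_
  have hsub : {X : Input n | 2 / 3 ≤ prob X (some (parity X)) ∧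
      prob X (some (!parity X)) = 0} ⊆ {X | 2 / 3 ≤ prob' X (parity X)} :=
    fun X hX => hX.1.trans (h X _)
  exact_mod_cast Set.ncard_le_ncard hsub (Set.toFinite _)

/-- Answering `false` instead of "don't know" cannot lower the probability of the correct bit. -/
theorem Q2_le_Q0 (n : ℕ) (ε : ℝ) : Q2 n ε ≤ Q0 n ε :=
  le_iInf₂ fun A hA => iInf₂_le (A.mapOutput fun o => o.getD false)
    (hA.solvesBoundedError fun X b => A.outputProb_mapOutput_ge _ X (some b))

theorem R2_le_R0 (n : ℕ) (ε : ℝ) : R2 n ε ≤ R0 n ε :=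
  le_iInf₂ fun A hA => by
    have hprob (X : Input n) (b : Bool) : RandomizedAlgorithm.outputProb A X (some b) ≤
        RandomizedAlgorithm.outputProb
          (RandomizedAlgorithm.mapOutput (fun o => o.getD false) A) X b := by
      have h := RandomizedAlgorithm.outputProb_mapOutput_ge (fun o => o.getD false) A X (some b)
      rwa [Option.getD_some] at h
    have hs := hA.solvesBoundedError hprob
    exact iInf_le_of_le _ (iInf_le_of_le hs (RandomizedAlgorithm.numQueries_mapOutput_le _ A))

theorem ofReal_le_of_forall_natCast {x : ℝ} {a : ℕ∞} (h : ∀ T : ℕ, a = T → x ≤ T) :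
    ENNReal.ofReal x ≤ (a : ℝ≥0∞) := by
  induction a using ENat.recTopCoe with
  | top => simp
  | coe T => simpa using ENNReal.ofReal_le_ofReal (h T rfl)

theorem le_Q2 {n : ℕ} {ε : ℝ} (hε : 0 < ε) (hε' : ε < 1 / 2) :
    ENNReal.ofReal (1 / 48 * n / Real.log (1 / ε)) ≤ (Q2 n ε : ℝ≥0∞) := by
  refine ofReal_le_of_forall_natCast fun T hT => ?_
  -- Strict inequality with `T + 1` extracts an algorithm making at most `T` queries from the
  -- infimum.
  have hlt : Q2 n ε < (T + 1 : ℕ) := by rw [hT]; exact_mod_cast T.lt_succ_self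
  obtain ⟨A, hA⟩ := iInf_lt_iff.1 hlt
  obtain ⟨hA, hAT⟩ := iInf_lt_iff.1 hA
  have hAT : A.numQueries ≤ T := Nat.lt_succ_iff.1 (by exact_mod_cast hAT)
  exact div_log_le_of_solves hε hε' A.outputProb_nonneg A.outputProb_true_add_false
    (degreeLE_mono (by omega) (A.outputProb_mem_degreeLE true)) hA

theorem le_R2 {n : ℕ} {ε : ℝ} (hε : 0 < ε) (hε' : ε < 1 / 2) :
    ENNReal.ofReal (1 / 48 * n / Real.log (1 / ε)) ≤ (R2 n ε : ℝ≥0∞) := by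
  refine ofReal_le_of_forall_natCast fun T hT => ?_
  have hlt : R2 n ε < (T + 1 : ℕ) := by rw [hT]; exact_mod_cast T.lt_succ_self
  obtain ⟨A, hA⟩ := iInf_lt_iff.1 hlt
  obtain ⟨hA, hAT⟩ := iInf_lt_iff.1 hA
  have hAT : RandomizedAlgorithm.numQueries A ≤ T :=
    ENat.lt_natCast_add_one_iff.1 (by exact_mod_cast hAT)
  exact div_log_le_of_solves hε hε' (fun _ _ => ENNReal.toReal_nonneg)
    (RandomizedAlgorithm.outputProb_true_add_false A)
    (degreeLE_mono (by omega) (RandomizedAlgorithm.outputProb_mem_degreeLE A true hAT)) hA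

end WeakParity

theorem mainTheorem2 :
    ∃ c : ℝ, 0 < c ∧ ∀ (n : ℕ) (ε : ℝ), 1 ≤ n → 0 < ε → ε < 1 / 2 →
      ENNReal.ofReal (c * n / Real.log (1 / ε)) ≤ (WeakParity.Q2 n ε : ℝ≥0∞) ∧
      ENNReal.ofReal (c * n / Real.log (1 / ε)) ≤ (WeakParity.Q0 n ε : ℝ≥0∞) ∧
      ENNReal.ofReal (c * n / Real.log (1 / ε)) ≤ (WeakParity.R2 n ε : ℝ≥0∞) ∧
      ENNReal.ofReal (c * n / Real.log (1 / ε)) ≤ (WeakParity.R0 n ε : ℝ≥0∞) := by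
  refine ⟨1 / 48, by norm_num, fun n ε _ hε hε' => ⟨WeakParity.le_Q2 hε hε', ?_,
    WeakParity.le_R2 hε hε', ?_⟩⟩
  · exact (WeakParity.le_Q2 hε hε').trans (ENat.toENNReal_le.2 (WeakParity.Q2_le_Q0 n ε))
  · exact (WeakParity.le_R2 hε hε').trans (ENat.toENNReal_le.2 (WeakParity.R2_le_R0 n ε))
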